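/- Let $\varphi:\mathbb{R}\to\mathbb{R}$ be continuous and let $D\in\mathbb{R}$ be such that $\varphi(x+1)=\varphi(x)+D$ for all $x\in\mathbb{R}$. Let $0<\delta<0.01$, and suppose that $D=0$ or $|D|>100\,\delta$ (which holds automatically when $D$ is an integer, in particular when $e^{2\pi i s}\mapsto e^{2\pi i\varphi(s)}$ is a well-defined map of the circle of degree $D$). Then \[ |D|\;\le\;10^9\,\delta\iint_{\{(s,t)\in[0,2]^2\;:\;|\varphi(s)-\varphi(t)|>\delta\}}\frac{ds\,dt}{|s-t|^2}. \] -/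

import Mathlib

open MeasureTheory

/-! Replacing `φ` by `-φ`, take `D > 0`. Cut a range of values of length `D` into about `D / (2 *
δ)` disjoint bands of height `2 * δ`; it suffices that most bands carry energy at least `1 / 32`,
charging a pair to the band containing the value at its first point. For each band, the intermediate
value theorem gives a unit window in which `f` spends equal time below and above it
(`exists_balanced_window`). If the band fills at most half of that window, repeated halving
preserves the balance and stops at a scale where the band and both sides are all dense
(`exists_window`). One half of the band is then dense and more than `δ` from the opposite side,
which gives the energy (`ofReal_le_lintegral_band`). Few bands can fill more than half a window,
since their total measure in `[0, 2]` is at most `2`. -/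

/-- A window over which `Φ` has zero increment contains a half-length window with zero increment. -/
lemma exists_half_window {Φ : ℝ → ℝ} (hΦ : Continuous Φ) {x h : ℝ} (hh : 0 ≤ h)
    (hx : Φ (x + 2 * h) = Φ x) : ∃ y ∈ Set.Icc x (x + h), Φ (y + h) = Φ y := by
  have hc : Continuous fun y => Φ (y + h) - Φ y := by fun_prop
  have h2 : x + h + h = x + 2 * h := by ring
  -- The increments over the two halves sum to zero, so they have opposite signs.
  have key : (0 : ℝ) ∈ Set.uIcc (Φ (x + h) - Φ x) (Φ (x + h + h) - Φ (x + h)) := by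
    rw [h2, hx, Set.mem_uIcc]
    rcases le_total (Φ (x + h)) (Φ x) with h' | h'
    · left; constructor <;> linarith
    · right; constructor <;> linarith
  obtain ⟨y, hy, hy0⟩ := intermediate_value_uIcc (a := x) (b := x + h) hc.continuousOn key
  rw [Set.uIcc_of_le (by linarith)] at hy
  exact ⟨y, hy, sub_eq_zero.1 hy0⟩

/-! ### Bands and balanced windows -/

/-- `1` below the band `[k, k + 2δ)`, `0` on it, `-1` above it. -/
noncomputable def bandSign (f : ℝ → ℝ) (δ k : ℝ) : ℝ → ℝ :=
  (f ⁻¹' Set.Iio k).indicator 1 - (f ⁻¹' Set.Ici (k + 2 * δ)).indicator 1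

section
variable {f : ℝ → ℝ} {δ k : ℝ}

lemma bandSign_of_lt {t : ℝ} (hδ : 0 < δ) (h : f t < k) : bandSign f δ k t = 1 := by
  have : ¬ k + 2 * δ ≤ f t := by linarith
  simp [bandSign, h, this, Set.indicator]

lemma bandSign_of_ge {t : ℝ} (hδ : 0 < δ) (h : k + 2 * δ ≤ f t) : bandSign f δ k t = -1 := by
  have : ¬ f t < k := by linarith
  simp [bandSign, h, this, Set.indicator]

lemma monotone_bandSign (t : ℝ) : Monotone fun k => bandSign f δ k t := by
  intro a b hab
  simp only [bandSign, Pi.sub_apply, Set.indicator, Set.mem_preimage, Set.mem_Iio, Set.mem_Ici,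
    Pi.one_apply]
  split_ifs <;> linarith

lemma intervalIntegrable_indicator_one {A : Set ℝ} (hA : MeasurableSet A) (a b : ℝ) :
    IntervalIntegrable (A.indicator (1 : ℝ → ℝ)) volume a b := by
  have h1 : IntervalIntegrable (1 : ℝ → ℝ) volume a b := continuous_one.intervalIntegrable a b
  exact ⟨h1.1.indicator hA, h1.2.indicator hA⟩

lemma intervalIntegrable_bandSign (hf : Continuous f) (a b : ℝ) :
    IntervalIntegrable (bandSign f δ k) volume a b :=
  (intervalIntegrable_indicator_one (measurableSet_Iio.preimage hf.measurable) a b).sub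
    (intervalIntegrable_indicator_one (measurableSet_Ici.preimage hf.measurable) a b)

lemma integral_indicator_one_Ioc {A : Set ℝ} (hA : MeasurableSet A) {a b : ℝ} (hab : a ≤ b) :
    ∫ t in a..b, A.indicator (1 : ℝ → ℝ) t = volume.real (A ∩ Set.Ioc a b) := by
  rw [intervalIntegral.integral_of_le hab, integral_indicator_one hA,
    measureReal_restrict_apply hA]

lemma integral_bandSign (hf : Continuous f) {a b : ℝ} (hab : a ≤ b) :
    ∫ t in a..b, bandSign f δ k t =
      volume.real (f ⁻¹' Set.Iio k ∩ Set.Ioc a b)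
        - volume.real (f ⁻¹' Set.Ici (k + 2 * δ) ∩ Set.Ioc a b) := by
  have hL : MeasurableSet (f ⁻¹' Set.Iio k) := measurableSet_Iio.preimage hf.measurable
  have hU : MeasurableSet (f ⁻¹' Set.Ici (k + 2 * δ)) := measurableSet_Ici.preimage hf.measurable
  rw [← integral_indicator_one_Ioc hL hab, ← integral_indicator_one_Ioc hU hab,
    ← intervalIntegral.integral_sub (intervalIntegrable_indicator_one hL a b)
      (intervalIntegrable_indicator_one hU a b)]
  rfl

lemma measureReal_inter_Ioc_mono (A : Set ℝ) {a b c d : ℝ} (hca : c ≤ a) (hbd : b ≤ d) :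
    volume.real (A ∩ Set.Ioc a b) ≤ volume.real (A ∩ Set.Ioc c d) :=
  measureReal_mono (Set.inter_subset_inter_right _ (Set.Ioc_subset_Ioc hca hbd))
    ((measure_mono Set.inter_subset_right).trans_lt measure_Ioc_lt_top).ne

lemma measureReal_below_add_band_add_above (hf : Continuous f) (hδ : 0 < δ) {a b : ℝ}
    (hab : a ≤ b) :
    volume.real (f ⁻¹' Set.Iio k ∩ Set.Ioc a b)
      + volume.real (f ⁻¹' Set.Ico k (k + 2 * δ) ∩ Set.Ioc a b)
      + volume.real (f ⁻¹' Set.Ici (k + 2 * δ) ∩ Set.Ioc a b) = b - a := by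
  have hL : MeasurableSet (f ⁻¹' Set.Iio k) := measurableSet_Iio.preimage hf.measurable
  have hB : MeasurableSet (f ⁻¹' Set.Ico k (k + 2 * δ)) :=
    measurableSet_Ico.preimage hf.measurable
  have hU : MeasurableSet (f ⁻¹' Set.Ici (k + 2 * δ)) := measurableSet_Ici.preimage hf.measurable
  rw [← integral_indicator_one_Ioc hL hab, ← integral_indicator_one_Ioc hB hab,
    ← integral_indicator_one_Ioc hU hab,
    ← intervalIntegral.integral_add (intervalIntegrable_indicator_one hL a b)
      (intervalIntegrable_indicator_one hB a b),
    ← intervalIntegral.integral_add ((intervalIntegrable_indicator_one hL a b).add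
      (intervalIntegrable_indicator_one hB a b)) (intervalIntegrable_indicator_one hU a b)]
  have : ∀ t, (f ⁻¹' Set.Iio k).indicator (1 : ℝ → ℝ) t
      + (f ⁻¹' Set.Ico k (k + 2 * δ)).indicator (1 : ℝ → ℝ) t
      + (f ⁻¹' Set.Ici (k + 2 * δ)).indicator (1 : ℝ → ℝ) t = 1 := by
    intro t
    simp only [Set.indicator, Set.mem_preimage, Set.mem_Iio, Set.mem_Ici, Set.mem_Ico,
      Pi.one_apply]
    split_ifs <;> grind
  simp [this]

/-- A balanced unit window that the band does not fill contains a window in which the band and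
both sides of it have density at least `1 / 4`. -/
lemma exists_window (hf : Continuous f) (hδ : 0 < δ) {x : ℝ}
    (hx : ∫ t in x..x + 1, bandSign f δ k t = 0)
    (hB : volume.real (f ⁻¹' Set.Ico k (k + 2 * δ) ∩ Set.Ioc x (x + 1)) ≤ 1 / 2) :
    ∃ y h, 0 < h ∧ x ≤ y ∧ y + h ≤ x + 1 ∧
      h / 4 ≤ volume.real (f ⁻¹' Set.Iio k ∩ Set.Ioc y (y + h)) ∧
      h / 4 ≤ volume.real (f ⁻¹' Set.Ico k (k + 2 * δ) ∩ Set.Ioc y (y + h)) ∧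
      h / 4 ≤ volume.real (f ⁻¹' Set.Ici (k + 2 * δ) ∩ Set.Ioc y (y + h)) := by
  -- Stopping time: `P` holds at scale `0` and fails at small scales, because a window satisfying it
  -- meets both sides of the band, so `f` varies by more than `2 * δ` there. The last good scale
  -- before a failure is used.
  let P : ℕ → Prop := fun n => ∃ y, x ≤ y ∧ y + (1 / 2) ^ n ≤ x + 1 ∧
    ∫ t in y..y + (1 / 2) ^ n, bandSign f δ k t = 0 ∧
    volume.real (f ⁻¹' Set.Ico k (k + 2 * δ) ∩ Set.Ioc y (y + (1 / 2) ^ n)) ≤ (1 / 2) ^ n / 2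
  have hP0 : P 0 := ⟨x, le_rfl, by simp, by simpa using hx, by simpa using hB⟩
  have hPn : ∃ n, ¬ P n := by
    have huc := isCompact_Icc.uniformContinuousOn_of_continuous
      (hf.continuousOn (s := Set.Icc x (x + 1)))
    obtain ⟨ε, hε, hlt⟩ := Metric.uniformContinuousOn_iff.1 huc (2 * δ) (by positivity)
    obtain ⟨n, hn⟩ := exists_pow_lt_of_lt_one hε (by norm_num : (1 / 2 : ℝ) < 1)
    refine ⟨n, ?_⟩
    rintro ⟨y, hxy, hyx, hs, hb⟩
    have hpos : (0 : ℝ) < (1 / 2) ^ n := by positivity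
    have hle : y ≤ y + (1 / 2) ^ n := by linarith
    have htot := measureReal_below_add_band_add_above (k := k) hf hδ hle
    rw [integral_bandSign hf hle] at hs
    have hLpos : volume.real (f ⁻¹' Set.Iio k ∩ Set.Ioc y (y + (1 / 2) ^ n)) ≠ 0 := by linarith
    have hUpos : volume.real (f ⁻¹' Set.Ici (k + 2 * δ) ∩ Set.Ioc y (y + (1 / 2) ^ n)) ≠ 0 := by
      linarith
    obtain ⟨a, ha, hay⟩ : (f ⁻¹' Set.Iio k ∩ Set.Ioc y (y + (1 / 2) ^ n)).Nonempty := by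
      by_contra hne
      exact hLpos (by rw [Set.not_nonempty_iff_eq_empty.1 hne]; simp)
    obtain ⟨b, hb, hby⟩ : (f ⁻¹' Set.Ici (k + 2 * δ) ∩ Set.Ioc y (y + (1 / 2) ^ n)).Nonempty := by
      by_contra hne
      exact hUpos (by rw [Set.not_nonempty_iff_eq_empty.1 hne]; simp)
    simp only [Set.mem_preimage, Set.mem_Iio, Set.mem_Ici, Set.mem_Ioc] at ha hb hay hby
    have := hlt b ⟨by linarith, by linarith⟩ a ⟨by linarith, by linarith⟩
      (by rw [Real.dist_eq, abs_lt]; constructor <;> linarith)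
    rw [Real.dist_eq, abs_lt] at this
    linarith
  obtain ⟨n, ⟨y, hxy, hyx, hs, hb⟩, hn⟩ : ∃ n, P n ∧ ¬ P (n + 1) := by
    by_contra! hcon
    obtain ⟨n, hn⟩ := hPn
    exact hn (Nat.rec hP0 hcon n)
  have hpos : (0 : ℝ) < (1 / 2) ^ n := by positivity
  have hle : y ≤ y + (1 / 2) ^ n := by linarith
  have hsucc : ((1 / 2 : ℝ)) ^ n = 2 * (1 / 2) ^ (n + 1) := by rw [pow_succ]; ring
  have hint := fun a b => intervalIntegrable_bandSign (δ := δ) (k := k) hf a b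
  have hinc : ∀ a b, (∫ t in (0 : ℝ)..b, bandSign f δ k t) = (∫ t in (0 : ℝ)..a, bandSign f δ k t)
      ↔ ∫ t in a..b, bandSign f δ k t = 0 := by
    intro a b
    rw [← intervalIntegral.integral_interval_sub_left (hint 0 b) (hint 0 a), sub_eq_zero]
  obtain ⟨z, hz, hz0⟩ := exists_half_window (x := y) (h := (1 / 2) ^ (n + 1))
    (intervalIntegral.continuous_primitive hint 0) (by positivity)
    (by rw [← hsucc]; exact (hinc _ _).2 hs)
  -- The half-window is balanced, so `P (n + 1)` can fail only because the band fills more than half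
  -- of it, hence more than a quarter of the parent.
  have hzB : (1 / 2) ^ (n + 1) / 2 <
      volume.real (f ⁻¹' Set.Ico k (k + 2 * δ) ∩ Set.Ioc z (z + (1 / 2) ^ (n + 1))) := by
    by_contra! hcon
    exact hn ⟨z, by linarith [hz.1], by linarith [hz.2], (hinc _ _).1 hz0, hcon⟩
  have hmono := measureReal_inter_Ioc_mono (f ⁻¹' Set.Ico k (k + 2 * δ)) (a := z)
    (b := z + (1 / 2) ^ (n + 1)) (c := y) (d := y + (1 / 2) ^ n) hz.1 (by linarith [hz.2])
  have htot := measureReal_below_add_band_add_above (k := k) hf hδ hle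
  rw [integral_bandSign hf hle] at hs
  exact ⟨y, (1 / 2) ^ n, hpos, hxy, hyx, by linarith, by linarith, by linarith⟩

/-! ### Energy of one band -/

/-- Energy of a product of two dense subsets of a window. -/
lemma ofReal_le_lintegral_inv_sq {A C : Set ℝ} {S : Set (ℝ × ℝ)} {y h α β : ℝ}
    (hA : MeasurableSet A) (hC : MeasurableSet C)
    (hh : 0 < h) (hα : 0 ≤ α)
    (hAα : α * h ≤ volume.real (A ∩ Set.Ioc y (y + h)))
    (hCβ : β * h ≤ volume.real (C ∩ Set.Ioc y (y + h)))
    (hdisj : Disjoint A C)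
    (hS : (A ∩ Set.Ioc y (y + h)) ×ˢ (C ∩ Set.Ioc y (y + h)) ⊆ S) :
    ENNReal.ofReal (α * β) ≤ ∫⁻ p in S, ENNReal.ofReal (1 / |p.1 - p.2| ^ 2) := by
  have hle : ∀ {T : Set ℝ} {γ : ℝ}, γ * h ≤ volume.real (T ∩ Set.Ioc y (y + h)) →
      ENNReal.ofReal (γ * h) ≤ volume (T ∩ Set.Ioc y (y + h)) := by
    intro T γ hγ
    rw [← ofReal_measureReal
      ((measure_mono Set.inter_subset_right).trans_lt measure_Ioc_lt_top).ne]
    exact ENNReal.ofReal_le_ofReal hγ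
  have hmeas : MeasurableSet ((A ∩ Set.Ioc y (y + h)) ×ˢ (C ∩ Set.Ioc y (y + h))) :=
    (hA.inter measurableSet_Ioc).prod (hC.inter measurableSet_Ioc)
  calc ENNReal.ofReal (α * β)
      = ENNReal.ofReal (1 / h ^ 2) * (ENNReal.ofReal (α * h) * ENNReal.ofReal (β * h)) := by
        rw [← ENNReal.ofReal_mul (by positivity), ← ENNReal.ofReal_mul (by positivity)]
        congr 1
        field_simp
    _ ≤ ENNReal.ofReal (1 / h ^ 2) *
          volume ((A ∩ Set.Ioc y (y + h)) ×ˢ (C ∩ Set.Ioc y (y + h))) := by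
        rw [Measure.volume_eq_prod, Measure.prod_prod]
        gcongr
        · exact hle hAα
        · exact hle hCβ
    _ ≤ ∫⁻ p in (A ∩ Set.Ioc y (y + h)) ×ˢ (C ∩ Set.Ioc y (y + h)),
          ENNReal.ofReal (1 / |p.1 - p.2| ^ 2) := by
        rw [← setLIntegral_const]
        refine setLIntegral_mono' hmeas ?_
        rintro ⟨a, c⟩ ⟨⟨haA, ha⟩, ⟨hcC, hc⟩⟩
        simp only [Set.mem_Ioc] at ha hc
        have hne : a ≠ c := fun hac => Set.disjoint_left.1 hdisj haA (hac ▸ hcC)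
        have h0 : 0 < |a - c| := abs_pos.2 (sub_ne_zero.2 hne)
        have h1 : |a - c| ≤ h := by rw [abs_le]; constructor <;> linarith
        exact ENNReal.ofReal_le_ofReal (by dsimp only; gcongr)
    _ ≤ _ := lintegral_mono_set hS

/-- Pairs in the square `[0, 2]²` whose images under `f` are more than `δ` apart. -/
def farPairs (f : ℝ → ℝ) (δ : ℝ) : Set (ℝ × ℝ) :=
  {p | p.1 ∈ Set.Icc (0 : ℝ) 2 ∧ p.2 ∈ Set.Icc (0 : ℝ) 2 ∧ δ < |f p.1 - f p.2|}

/-- Each band crossed by a balanced window carries a fixed amount of energy. -/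
lemma ofReal_le_lintegral_band (hf : Continuous f) (hδ : 0 < δ) {x : ℝ} (hx0 : 0 ≤ x) (hx1 : x ≤ 1)
    (hx : ∫ t in x..x + 1, bandSign f δ k t = 0)
    (hB : volume.real (f ⁻¹' Set.Ico k (k + 2 * δ) ∩ Set.Ioc x (x + 1)) ≤ 1 / 2) :
    ENNReal.ofReal (1 / 32) ≤
      ∫⁻ p in farPairs f δ ∩ {p | f p.1 ∈ Set.Ico k (k + 2 * δ)},
        ENNReal.ofReal (1 / |p.1 - p.2| ^ 2) := by
  obtain ⟨y, h, hh, hxy, hyx, hL, hM, hU⟩ := exists_window hf hδ hx hB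
  have hsplit : f ⁻¹' Set.Ico k (k + 2 * δ) ∩ Set.Ioc y (y + h) =
      (f ⁻¹' Set.Ico k (k + δ) ∩ Set.Ioc y (y + h)) ∪
        (f ⁻¹' Set.Ico (k + δ) (k + 2 * δ) ∩ Set.Ioc y (y + h)) := by
    rw [← Set.union_inter_distrib_right, ← Set.preimage_union,
      Set.Ico_union_Ico_eq_Ico (by linarith) (by linarith)]
  have hadd := measureReal_union_le (μ := volume) (f ⁻¹' Set.Ico k (k + δ) ∩ Set.Ioc y (y + h))
    (f ⁻¹' Set.Ico (k + δ) (k + 2 * δ) ∩ Set.Ioc y (y + h))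
  rw [← hsplit] at hadd
  rw [show (1 / 32 : ℝ) = 1 / 8 * (1 / 4) by norm_num]
  -- The denser half of the band has density at least `1 / 8`; it is paired with the side it does
  -- not touch.
  rcases le_total (h / 8) (volume.real (f ⁻¹' Set.Ico k (k + δ) ∩ Set.Ioc y (y + h))) with h8 | h8
  · refine ofReal_le_lintegral_inv_sq (y := y) (h := h)
      (measurableSet_Ico.preimage hf.measurable) (measurableSet_Ici.preimage hf.measurable)
      hh (by norm_num) (by linarith) (by linarith : 1 / 4 * h ≤ volume.real
        (f ⁻¹' Set.Ici (k + 2 * δ) ∩ Set.Ioc y (y + h))) ?_ ?_ (A := f ⁻¹' Set.Ico k (k + δ))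
    · refine Set.disjoint_left.2 fun t ht ht' => ?_
      simp only [Set.mem_preimage, Set.mem_Ico, Set.mem_Ici] at ht ht'
      linarith
    · rintro ⟨a, c⟩ ⟨⟨ha, hay⟩, ⟨hc, hcy⟩⟩
      simp only [Set.mem_preimage, Set.mem_Ico, Set.mem_Ici, Set.mem_Ioc] at ha hay hc hcy
      refine ⟨⟨⟨by linarith, by linarith⟩, ⟨by linarith, by linarith⟩, ?_⟩,
        ⟨by linarith, by dsimp only; linarith⟩⟩
      rw [lt_abs]; right; dsimp only; linarith
  · refine ofReal_le_lintegral_inv_sq (y := y) (h := h)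
      (measurableSet_Ico.preimage hf.measurable) (measurableSet_Iio.preimage hf.measurable)
      hh (by norm_num) (by linarith) (by linarith : 1 / 4 * h ≤ volume.real
        (f ⁻¹' Set.Iio k ∩ Set.Ioc y (y + h))) ?_ ?_ (A := f ⁻¹' Set.Ico (k + δ) (k + 2 * δ))
    · refine Set.disjoint_left.2 fun t ht ht' => ?_
      simp only [Set.mem_preimage, Set.mem_Ico, Set.mem_Iio] at ht ht'
      linarith
    · rintro ⟨a, c⟩ ⟨⟨ha, hay⟩, ⟨hc, hcy⟩⟩
      simp only [Set.mem_preimage, Set.mem_Ico, Set.mem_Iio, Set.mem_Ioc] at ha hay hc hcy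
      refine ⟨⟨⟨by linarith, by linarith⟩, ⟨by linarith, by linarith⟩, ?_⟩,
        ⟨by dsimp only; linarith, by linarith⟩⟩
      rw [lt_abs]; left; dsimp only; linarith

/-! ### Existence of balanced windows -/

/-- For every level in an interval of length `D` there is a balanced unit window. -/
lemma exists_balanced_window {D : ℝ} (hf : Continuous f) (hD : ∀ x, f (x + 1) = f x + D)
    (hδ : 0 < δ) : ∃ m : ℝ, ∀ k, m < k → k < m + D →
      ∃ x ∈ Set.Icc (0 : ℝ) 1, ∫ t in x..x + 1, bandSign f δ k t = 0 := by
  let G : ℝ → ℝ := fun k => ∫ t in (0 : ℝ)..1, bandSign f δ k t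
  have hGmono : Monotone G := fun a b hab =>
    intervalIntegral.integral_mono_on zero_le_one (intervalIntegrable_bandSign hf _ _)
      (intervalIntegrable_bandSign hf _ _) fun t _ => monotone_bandSign t hab
  have hshift : ∀ k, ∫ t in (1 : ℝ)..1 + 1, bandSign f δ k t = G (k - D) := by
    intro k
    have h := intervalIntegral.integral_comp_add_right (a := 0) (b := 1) (bandSign f δ k) (1 : ℝ)
    rw [zero_add] at h
    rw [← h]
    refine intervalIntegral.integral_congr fun t _ => ?_
    have e1 : f t + D < k ↔ f t < k - D := by constructor <;> intro <;> linarith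
    have e2 : k + 2 * δ ≤ f t + D ↔ k - D + 2 * δ ≤ f t := by constructor <;> intro <;> linarith
    simp only [bandSign, Pi.sub_apply, Set.indicator, Set.mem_preimage, Set.mem_Iio, Set.mem_Ici,
      hD, e1, e2, Pi.one_apply]
  obtain ⟨M, hM⟩ := (isCompact_Icc (a := (0 : ℝ)) (b := 1)).exists_bound_of_continuousOn
    hf.continuousOn
  have hlow : G (-M - 2 * δ) ≤ 0 := by
    have : G (-M - 2 * δ) = ∫ t in (0 : ℝ)..1, (-1 : ℝ) := by
      refine intervalIntegral.integral_congr fun t ht => ?_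
      rw [Set.uIcc_of_le zero_le_one] at ht
      have := (abs_le.1 (hM t ht)).1
      exact bandSign_of_ge hδ (by linarith)
    rw [this]; norm_num
  have hhigh : 0 < G (M + 1) := by
    have : G (M + 1) = ∫ t in (0 : ℝ)..1, (1 : ℝ) := by
      refine intervalIntegral.integral_congr fun t ht => ?_
      rw [Set.uIcc_of_le zero_le_one] at ht
      have := (abs_le.1 (hM t ht)).2
      exact bandSign_of_lt hδ (by linarith)
    rw [this]; norm_num
  have hbdd : BddAbove {k | G k ≤ 0} := by
    refine ⟨M + 1, fun k hk => ?_⟩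
    by_contra! hlt
    exact absurd (hGmono hlt.le) (not_le.2 (lt_of_le_of_lt hk hhigh))
  -- For `k` between this supremum and its translate by `D`, `G k ≥ 0 ≥ G (k - D)`: the balances on
  -- `[0, 1]` and `[1, 2]` have opposite signs.
  refine ⟨sSup {k | G k ≤ 0}, fun k hk hkD => ?_⟩
  have h0 : 0 ≤ G k := by
    by_contra! hlt
    exact absurd (le_csSup hbdd hlt.le) (not_le.2 hk)
  have h1 : G (k - D) ≤ 0 := by
    obtain ⟨k', hk', hlt⟩ := exists_lt_of_lt_csSup (s := {k | G k ≤ 0}) ⟨_, hlow⟩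
      (by linarith : k - D < _)
    exact (hGmono hlt.le).trans hk'
  have hint := fun a b => intervalIntegrable_bandSign (δ := δ) (k := k) hf a b
  have hcont : Continuous fun x => ∫ t in x..x + 1, bandSign f δ k t := by
    have hp := intervalIntegral.continuous_primitive hint 0
    have : (fun x => ∫ t in x..x + 1, bandSign f δ k t) = fun x =>
        (∫ t in (0 : ℝ)..x + 1, bandSign f δ k t) - ∫ t in (0 : ℝ)..x, bandSign f δ k t := by
      funext x
      rw [intervalIntegral.integral_interval_sub_left (hint _ _) (hint _ _)]
    rw [this]
    exact (hp.comp (continuous_add_const 1)).sub hp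
  obtain ⟨x, hx, hx0⟩ := intermediate_value_Icc' zero_le_one hcont.continuousOn
    (show (0 : ℝ) ∈ Set.Icc _ _ from ⟨(hshift k).le.trans h1, by simpa using h0⟩)
  exact ⟨x, hx, hx0⟩

/-! ### Summation over bands -/

/-- The energy estimate for positive degree. -/
lemma ofReal_le_mul_lintegral_farPairs {D : ℝ} (hf : Continuous f)
    (hD : ∀ x, f (x + 1) = f x + D) (hδ : 0 < δ) (hDδ : 100 * δ < D) :
    ENNReal.ofReal D ≤ ENNReal.ofReal (10 ^ 9 * δ) *
      ∫⁻ p in farPairs f δ, ENNReal.ofReal (1 / |p.1 - p.2| ^ 2) := by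
  obtain ⟨m, hm⟩ := exists_balanced_window hf hD hδ
  set n : ℕ := ⌊D / (2 * δ)⌋₊ with hn
  have hn1 : (n : ℝ) * (2 * δ) ≤ D :=
    (le_div_iff₀ (by positivity)).1 (Nat.floor_le (div_nonneg (by linarith) (by positivity)))
  have hn2 : D < (n + 1) * (2 * δ) := (div_lt_iff₀ (by positivity)).1 (Nat.lt_floor_add_one _)
  -- The offset `δ` keeps the levels with `j < n` strictly between `m` and `m + D`.
  let k : ℕ → ℝ := fun j => m + δ + j * (2 * δ)
  let b : ℕ → ℝ := fun j => volume.real (f ⁻¹' Set.Ico (k j) (k j + 2 * δ) ∩ Set.Ioc 0 2)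
  let S : ℕ → Set (ℝ × ℝ) := fun j =>
    farPairs f δ ∩ {p | f p.1 ∈ Set.Ico (k j) (k j + 2 * δ)}
  have hdisj : Pairwise (Function.onFun Disjoint fun j => Set.Ico (k j) (k j + 2 * δ)) := by
    refine (pairwise_disjoint_on _).2 fun i j hij => ?_
    have hij' : ((i : ℝ) + 1) * (2 * δ) ≤ j * (2 * δ) := by
      gcongr
      exact_mod_cast hij
    refine Set.disjoint_left.2 fun t ht ht' => ?_
    simp only [k, Set.mem_Ico] at ht ht'
    linarith
  have hfar : MeasurableSet (farPairs f δ) := by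
    have h1 : MeasurableSet {p : ℝ × ℝ | p.1 ∈ Set.Icc (0 : ℝ) 2} :=
      measurable_fst measurableSet_Icc
    have h2 : MeasurableSet {p : ℝ × ℝ | p.2 ∈ Set.Icc (0 : ℝ) 2} :=
      measurable_snd measurableSet_Icc
    have h3 : MeasurableSet {p : ℝ × ℝ | δ < |f p.1 - f p.2|} :=
      (isOpen_lt continuous_const (by fun_prop)).measurableSet
    exact h1.inter (h2.inter h3)
  have hSmeas : ∀ j, MeasurableSet (S j) := fun j =>
    hfar.inter ((hf.measurable.comp measurable_fst) measurableSet_Ico)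
  have hSdisj : Pairwise (Function.onFun Disjoint S) := fun i j hij =>
    Set.disjoint_left.2 fun p hp hp' => Set.disjoint_left.1 (hdisj hij) hp.2 hp'.2
  have hb : ∑ j ∈ Finset.range n, b j ≤ 2 := by
    have h1 : ∑ j ∈ Finset.range n, b j =
        volume.real (⋃ j ∈ Finset.range n,
          f ⁻¹' Set.Ico (k j) (k j + 2 * δ) ∩ Set.Ioc (0 : ℝ) 2) := by
      refine (measureReal_biUnion_finset (fun i _ j _ hij => ?_) (fun j _ =>
        (measurableSet_Ico.preimage hf.measurable).inter measurableSet_Ioc) (fun j _ => ?_)).symm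
      · exact ((hdisj hij).preimage f).mono Set.inter_subset_left Set.inter_subset_left
      · exact ((measure_mono Set.inter_subset_right).trans_lt measure_Ioc_lt_top).ne
    have h2 : volume.real (⋃ j ∈ Finset.range n,
          f ⁻¹' Set.Ico (k j) (k j + 2 * δ) ∩ Set.Ioc (0 : ℝ) 2) ≤
        volume.real (Set.Ioc (0 : ℝ) 2) :=
      measureReal_mono (Set.iUnion₂_subset fun _ _ => Set.inter_subset_right)
        measure_Ioc_lt_top.ne
    rw [h1]
    simpa using h2
  -- The weight `1 - 2 * b j` is negative exactly for bands of measure above `1 / 2`, so those need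
  -- no separate count; summing loses at most `4`.
  have hband : ∀ j ∈ Finset.range n, ENNReal.ofReal ((1 - 2 * b j) / 32) ≤
      ∫⁻ p in S j, ENNReal.ofReal (1 / |p.1 - p.2| ^ 2) := by
    intro j hj
    have hj' : (j : ℝ) + 1 ≤ n := by exact_mod_cast Finset.mem_range.1 hj
    rcases le_or_gt (b j) (1 / 2) with hbj | hbj
    · have hjn : ((j : ℝ) + 1) * (2 * δ) ≤ n * (2 * δ) := by gcongr
      have hj0 : 0 ≤ (j : ℝ) * (2 * δ) := by positivity
      obtain ⟨x, hx, hx0⟩ := hm (k j) (by simp only [k]; linarith) (by simp only [k]; linarith)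
      refine le_trans (ENNReal.ofReal_le_ofReal ?_) (ofReal_le_lintegral_band hf hδ hx.1 hx.2 hx0
        ((measureReal_inter_Ioc_mono _ hx.1 (by linarith [hx.2])).trans hbj))
      have : 0 ≤ b j := measureReal_nonneg
      linarith
    · rw [ENNReal.ofReal_of_nonpos (by linarith)]
      exact zero_le
  have hE : ENNReal.ofReal ((n - 4) / 32) ≤
      ∫⁻ p in farPairs f δ, ENNReal.ofReal (1 / |p.1 - p.2| ^ 2) := by
    calc ENNReal.ofReal ((n - 4) / 32)
        ≤ ENNReal.ofReal (∑ j ∈ Finset.range n, (1 - 2 * b j) / 32) := by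
          refine ENNReal.ofReal_le_ofReal ?_
          rw [← Finset.sum_div, Finset.sum_sub_distrib, ← Finset.mul_sum]
          simp only [Finset.sum_const, Finset.card_range, nsmul_eq_mul, mul_one]
          linarith
      _ ≤ ∑ j ∈ Finset.range n, ENNReal.ofReal ((1 - 2 * b j) / 32) :=
          Finset.le_sum_of_subadditive _ ENNReal.ofReal_zero.le
            (fun _ _ => ENNReal.ofReal_add_le) _ _
      _ ≤ ∑ j ∈ Finset.range n, ∫⁻ p in S j, ENNReal.ofReal (1 / |p.1 - p.2| ^ 2) :=
          Finset.sum_le_sum hband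
      _ = ∫⁻ p in ⋃ j ∈ Finset.range n, S j, ENNReal.ofReal (1 / |p.1 - p.2| ^ 2) :=
          (lintegral_biUnion_finset (fun i _ j _ hij => hSdisj hij) (fun j _ => hSmeas j) _).symm
      _ ≤ _ := lintegral_mono_set (Set.iUnion₂_subset fun _ _ => Set.inter_subset_left)
  -- From `100 * δ < D`, `δ * (n - 4) > D / 2 - 5 * δ > 9 * D / 20`, so the constant has ample room.
  calc ENNReal.ofReal D ≤ ENNReal.ofReal (10 ^ 9 * δ * ((n - 4) / 32)) := by
        refine ENNReal.ofReal_le_ofReal ?_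
        linarith
    _ = ENNReal.ofReal (10 ^ 9 * δ) * ENNReal.ofReal ((n - 4) / 32) :=
        ENNReal.ofReal_mul (by positivity)
    _ ≤ _ := by gcongr

end

theorem theorem1 (φ : ℝ → ℝ) (hφ : Continuous φ) (D : ℝ)
    (hD : ∀ x : ℝ, φ (x + 1) = φ x + D)
    (δ : ℝ) (hδ0 : 0 < δ) (hδ : δ < 0.01)
    (hDδ : D = 0 ∨ 100 * δ < |D|) :
    ENNReal.ofReal |D| ≤
      ENNReal.ofReal (10 ^ 9 * δ) *
        ∫⁻ p in {p : ℝ × ℝ | p.1 ∈ Set.Icc (0 : ℝ) 2 ∧ p.2 ∈ Set.Icc (0 : ℝ) 2 ∧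
            δ < |φ p.1 - φ p.2|},
          ENNReal.ofReal (1 / |p.1 - p.2| ^ 2) := by
  rcases hDδ with rfl | hDδ
  · simp
  rcases le_total 0 D with h0 | h0
  · rw [abs_of_nonneg h0] at hDδ ⊢
    exact ofReal_le_mul_lintegral_farPairs hφ hD hδ0 hDδ
  · rw [abs_of_nonpos h0] at hDδ ⊢
    have h := ofReal_le_mul_lintegral_farPairs (f := fun x => -φ x) hφ.neg
      (fun x => by rw [hD]; ring) hδ0 hDδ
    have hset : farPairs (fun x => -φ x) δ = farPairs φ δ := by
      ext p
      simp only [farPairs, Set.mem_ofPred_eq, neg_sub_neg, abs_sub_comm (φ p.2)]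
    rw [hset] at h
    exact h
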